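/- Let $P(\mathbb{R})$ be the set of $f\in L^1(\mathbb{R})$ with $f\ge 0$ and $\int_{\mathbb{R}} f(t)\,dt=1$ (as usual, relations between elements of $L^1(\mathbb{R})$, including evenness $f(-t)=f(t)$, hold almost everywhere). For $f\in P(\mathbb{R})$ and $r>0$ put $f_r(t)=r^{-1}f(t/r)$, and for a complex-valued $\phi\in L^\infty(\mathbb{R})$ put $$(f*\phi)(x)=\int_{\mathbb{R}}\phi(x-t)f(t)\,dt\qquad(x\in\mathbb{R}).$$ Theorem 4.5. Let $\phi\in L^\infty(\mathbb{R})$, and let $f\in P(\mathbb{R})$ be even with $$\int_0^\infty f(t)\,t^{i\xi}\,dt\neq 0\qquad\text{for every }\xi\in\mathbb{R}.$$ Let $\gamma=0^+$ or $\gamma=\infty$, let $x\in\mathbb{R}$ and $\alpha\in\mathbb{C}$. If $$\lim_{r\to\gamma}(f_r*\phi)(x)=\alpha,$$ then for every even $g\in P(\mathbb{R})$, $$\lim_{r\to\gamma}(g_r*\phi)(x)=\alpha.$$ -/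

import Mathlib

open MeasureTheory Filter Topology
open scoped Convolution ENNReal

/-- `f ∈ P(ℝ)`: `f` is (a representative of) an element of `L¹(ℝ)` with `f ≥ 0` almost everywhere
and `∫ f = 1`. -/
structure MemP (f : ℝ → ℝ) : Prop where
  integrable : Integrable f volume
  nonneg : ∀ᵐ x : ℝ, 0 ≤ f x
  integral_eq_one : ∫ x : ℝ, f x = 1

/-- Evenness of (the class of) a function on the line: `f (-x) = f x` for almost every `x`. -/
def IsEvenAE (f : ℝ → ℝ) : Prop :=
  ∀ᵐ x : ℝ, f (-x) = f x

/-- The dilation `f_r(x) = r⁻¹ f(x / r)`; it is used for `r > 0` only. -/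
noncomputable def dilate (f : ℝ → ℝ) (r : ℝ) : ℝ → ℝ :=
  fun x => r⁻¹ * f (x / r)

/-!
Writing `r = exp ρ` and folding the line at `x`, the mean `(f_r * φ)(x)` of an even `f` becomes the
convolution at `ρ` of an integrable kernel, whose Fourier transform is the Mellin transform of `f`
on the line `Re s = 1`, with a bounded function `ψ`. Multiplication of `r` by a constant is a
translation in `ρ`, so the claim is Wiener's Tauberian theorem: if `F` is integrable with
nonvanishing Fourier transform, `ψ` is bounded and `F ⋆ ψ → 0`, then `G ⋆ ψ → 0` for every
integrable `G`.

Wiener's theorem is proved by local inversion in frequency. If `k` is a kernel whose transform is a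
narrow plateau around `η`, then `F ⋆ k` differs from `𝓕 F η • k` by an `L¹` error smaller than
`‖𝓕 F η‖`. For `u` band-limited to the plateau, `θ = u ⋆ ψ` satisfies `k ⋆ θ = θ`, hence
`‖𝓕 F η‖ * limsup ‖θ‖ ≤ ‖error‖₁ * limsup ‖θ‖`, which forces `θ → 0`. A partition of unity extends
this to all `u` with smooth compactly supported transform, and `u ⋆ G` can be made `L¹`-close to `G`
by taking the transform of `u` equal to `1` on a large ball.
-/

open ContinuousLinearMap (lsmul)
open scoped FourierTransform RealInnerProductSpace SchwartzMap

section Limsup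

variable {X ι : Type*} [MeasurableSpace X] {μ : Measure X} {l : Filter ι}

theorem limsup_lintegral_le_of_isCountablyGenerated [l.IsCountablyGenerated]
    {f : ι → X → ℝ≥0∞} (g : X → ℝ≥0∞) (hf : ∀ i, AEMeasurable (f i) μ)
    (hfg : ∀ i, f i ≤ᵐ[μ] g) (hg : ∫⁻ x, g x ∂μ ≠ ∞) :
    limsup (fun i => ∫⁻ x, f i x ∂μ) l ≤ ∫⁻ x, limsup (f · x) l ∂μ := by
  refine le_of_forall_lt_imp_le_of_dense fun c hc => ?_
  obtain ⟨i, hil, hci⟩ := exists_seq_forall_of_frequently (frequently_lt_of_lt_limsup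
    (by isBoundedDefault) hc)
  calc c ≤ limsup (fun n => ∫⁻ x, f (i n) x ∂μ) atTop :=
        le_limsup_of_frequently_le (Frequently.of_forall fun n => (hci n).le)
    _ = limsup (fun n => ∫⁻ x, (hf (i n)).mk _ x ∂μ) atTop := by
        simp_rw [fun n => lintegral_congr_ae (hf (i n)).ae_eq_mk]
    _ ≤ ∫⁻ x, limsup (fun n => (hf (i n)).mk _ x) atTop ∂μ :=
        limsup_lintegral_le g (fun n => (hf (i n)).measurable_mk)
          (fun n => (hf (i n)).ae_eq_mk.symm.trans_le (hfg (i n))) hg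
    _ = ∫⁻ x, limsup (fun n => f (i n) x) atTop ∂μ := by
        refine lintegral_congr_ae ?_
        filter_upwards [ae_all_iff.2 fun n => (hf (i n)).ae_eq_mk] with x hx
        simp_rw [hx]
    _ ≤ ∫⁻ x, limsup (f · x) l ∂μ :=
        lintegral_mono fun x => (limsup_comp (f · x) i atTop).trans_le (limsup_le_limsup_of_le hil)

theorem tendsto_zero_iff_limsup_enorm_eq_zero {E : Type*} [SeminormedAddCommGroup E] {f : ι → E} :
    Tendsto f l (𝓝 0) ↔ limsup (fun i => ‖f i‖ₑ) l = 0 := by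
  rw [tendsto_zero_iff_enorm_tendsto_zero]
  rcases l.eq_or_neBot with rfl | _
  · simp
  exact ⟨Tendsto.limsup_eq, fun h => tendsto_of_le_liminf_of_limsup_le bot_le h.le⟩

end Limsup

section BoundedConvolution

theorem memLp_top_comp_of_quasiMeasurePreserving {X Y E : Type*} [MeasurableSpace X]
    [MeasurableSpace Y] {μ : Measure X} {ν : Measure Y} [NormedAddCommGroup E] {ψ : Y → E}
    (hψ : MemLp ψ ∞ ν) {f : X → Y} (hf : Measure.QuasiMeasurePreserving f μ ν) :
    MemLp (ψ ∘ f) ∞ μ := by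
  refine ⟨hψ.1.comp_quasiMeasurePreserving hf, ?_⟩
  rw [eLpNorm_exponent_top]
  exact (eLpNormEssSup_le_of_ae_enorm_bound (hf.ae ae_le_eLpNormEssSup)).trans_lt hψ.2

theorem lintegral_enorm_mul_const {X : Type*} [MeasurableSpace X] {μ : Measure X} {F : X → ℂ}
    (hF : AEStronglyMeasurable F μ) (c : ℝ≥0∞) :
    ∫⁻ y, ‖F y‖ₑ * c ∂μ = eLpNorm F 1 μ * c := by
  rw [lintegral_mul_const'' _ hF.enorm, eLpNorm_one_eq_lintegral_enorm]

variable {A E : Type*} [AddCommGroup A] [MeasurableSpace A] {μ : Measure A}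
  [NormedAddCommGroup E] {F G : A → ℂ} {ψ : A → E} {l : Filter A}

theorem enorm_convolution_le [NormedSpace ℂ E] (x : A) :
    ‖(F ⋆[lsmul ℂ ℂ, μ] ψ) x‖ₑ ≤ ∫⁻ y, ‖F y‖ₑ * ‖ψ (x - y)‖ₑ ∂μ := by
  simpa only [convolution_lsmul, enorm_smul] using
    enorm_integral_le_lintegral_enorm fun y => F y • ψ (x - y)

variable [MeasurableAdd₂ A] [MeasurableNeg A] [μ.IsAddLeftInvariant] [μ.IsNegInvariant]

theorem convolution_lsmul_comm : F ⋆[lsmul ℂ ℂ, μ] G = G ⋆[lsmul ℂ ℂ, μ] F := by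
  ext x
  rw [convolution_lsmul_swap, convolution_lsmul]
  simp only [smul_eq_mul, mul_comm]

theorem memLp_top_comp_sub_left (hψ : MemLp ψ ∞ μ) (x : A) : MemLp (fun y => ψ (x - y)) ∞ μ :=
  hψ.comp_measurePreserving (Measure.measurePreserving_sub_left μ x)

theorem enorm_mul_enorm_comp_sub_left_ae_le (hψ : MemLp ψ ∞ μ) (x : A) :
    (fun y => ‖F y‖ₑ * ‖ψ (x - y)‖ₑ) ≤ᵐ[μ] fun y => ‖F y‖ₑ * eLpNorm ψ ∞ μ := by
  rw [← eLpNorm_comp_measurePreserving hψ.1 (Measure.measurePreserving_sub_left μ x),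
    eLpNorm_exponent_top]
  filter_upwards [ae_le_eLpNormEssSup (f := ψ ∘ (x - ·)) (μ := μ)] with y hy
  gcongr
  exact hy

variable [NormedSpace ℂ E]

theorem convolutionExists_of_integrable_of_memLp_top (hF : Integrable F μ) (hψ : MemLp ψ ∞ μ) :
    ConvolutionExists F ψ (lsmul ℂ ℂ) μ := fun x =>
  hF.smul_of_top_left (memLp_top_comp_sub_left hψ x)

theorem enorm_convolution_le_eLpNorm_mul (hF : Integrable F μ) (hψ : MemLp ψ ∞ μ) (x : A) :
    ‖(F ⋆[lsmul ℂ ℂ, μ] ψ) x‖ₑ ≤ eLpNorm F 1 μ * eLpNorm ψ ∞ μ :=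
  calc ‖(F ⋆[lsmul ℂ ℂ, μ] ψ) x‖ₑ ≤ ∫⁻ y, ‖F y‖ₑ * ‖ψ (x - y)‖ₑ ∂μ := enorm_convolution_le x
    _ ≤ ∫⁻ y, ‖F y‖ₑ * eLpNorm ψ ∞ μ ∂μ :=
        lintegral_mono_ae (enorm_mul_enorm_comp_sub_left_ae_le hψ x)
    _ = eLpNorm F 1 μ * eLpNorm ψ ∞ μ := lintegral_enorm_mul_const hF.1 _

theorem limsup_enorm_convolution_le [l.IsCountablyGenerated]
    (hl : ∀ y, Tendsto (· - y) l l) (hF : Integrable F μ) (hψ : MemLp ψ ∞ μ) :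
    limsup (fun x => ‖(F ⋆[lsmul ℂ ℂ, μ] ψ) x‖ₑ) l ≤
      eLpNorm F 1 μ * limsup (fun x => ‖ψ x‖ₑ) l :=
  calc limsup (fun x => ‖(F ⋆[lsmul ℂ ℂ, μ] ψ) x‖ₑ) l
      ≤ limsup (fun x => ∫⁻ y, ‖F y‖ₑ * ‖ψ (x - y)‖ₑ ∂μ) l :=
        limsup_le_limsup (.of_forall enorm_convolution_le)
    _ ≤ ∫⁻ y, limsup (fun x => ‖F y‖ₑ * ‖ψ (x - y)‖ₑ) l ∂μ := by
        refine limsup_lintegral_le_of_isCountablyGenerated (fun y => ‖F y‖ₑ * eLpNorm ψ ∞ μ)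
          (fun x => hF.1.enorm.mul (memLp_top_comp_sub_left hψ x).1.enorm)
          (enorm_mul_enorm_comp_sub_left_ae_le hψ) ?_
        rw [lintegral_enorm_mul_const hF.1]
        exact (ENNReal.mul_lt_top (memLp_one_iff_integrable.2 hF).2 hψ.2).ne
    _ ≤ ∫⁻ y, ‖F y‖ₑ * limsup (fun x => ‖ψ x‖ₑ) l ∂μ := by
        refine lintegral_mono fun y => ?_
        rw [ENNReal.limsup_const_mul_of_ne_top enorm_ne_top]
        gcongr
        exact (limsup_comp (fun x => ‖ψ x‖ₑ) (· - y) l).trans_le (limsup_le_limsup_of_le (hl y))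
    _ = eLpNorm F 1 μ * limsup (fun x => ‖ψ x‖ₑ) l := lintegral_enorm_mul_const hF.1 _

theorem tendsto_convolution_zero [l.IsCountablyGenerated]
    (hl : ∀ y, Tendsto (· - y) l l) (hF : Integrable F μ) (hψ : MemLp ψ ∞ μ)
    (h : Tendsto ψ l (𝓝 0)) : Tendsto (F ⋆[lsmul ℂ ℂ, μ] ψ) l (𝓝 0) := by
  rw [tendsto_zero_iff_limsup_enorm_eq_zero] at h ⊢
  simpa only [h, mul_zero, nonpos_iff_eq_zero] using limsup_enorm_convolution_le hl hF hψ

theorem tendsto_zero_of_tendsto_convolution_add_smul [l.IsCountablyGenerated]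
    (hl : ∀ y, Tendsto (· - y) l l) {D : A → ℂ} (hD : Integrable D μ) {θ : A → E}
    (hθ : MemLp θ ∞ μ) (hθ_fin : limsup (fun x => ‖θ x‖ₑ) l ≠ ∞) {c : ℂ}
    (hDc : eLpNorm D 1 μ < ‖c‖ₑ) (h : Tendsto (D ⋆[lsmul ℂ ℂ, μ] θ + c • θ) l (𝓝 0)) :
    Tendsto θ l (𝓝 0) := by
  rw [tendsto_zero_iff_limsup_enorm_eq_zero]
  rw [tendsto_zero_iff_enorm_tendsto_zero] at h
  set L := limsup (fun x => ‖θ x‖ₑ) l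
  have h_enorm (x : A) : ‖c • θ x‖ₑ ≤
      ‖(D ⋆[lsmul ℂ ℂ, μ] θ + c • θ) x‖ₑ + ‖(D ⋆[lsmul ℂ ℂ, μ] θ) x‖ₑ := by
    simpa using enorm_sub_le (a := (D ⋆[lsmul ℂ ℂ, μ] θ + c • θ) x)
      (b := (D ⋆[lsmul ℂ ℂ, μ] θ) x)
  have h_le : ‖c‖ₑ * L ≤ eLpNorm D 1 μ * L :=
    calc ‖c‖ₑ * L = limsup (fun x => ‖c • θ x‖ₑ) l := by
          simp_rw [enorm_smul, L, ENNReal.limsup_const_mul_of_ne_top enorm_ne_top]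
      _ ≤ limsup (fun x => ‖(D ⋆[lsmul ℂ ℂ, μ] θ) x‖ₑ) l := by
          rw [← ENNReal.limsup_add_of_left_tendsto_zero h (‖(D ⋆[lsmul ℂ ℂ, μ] θ) ·‖ₑ)]
          exact limsup_le_limsup (.of_forall h_enorm)
      _ ≤ eLpNorm D 1 μ * L := limsup_enorm_convolution_le hl hD hθ
  by_contra hL
  exact h_le.not_gt (ENNReal.mul_lt_mul_left hL hθ_fin hDc)

theorem tendsto_convolution_zero_of_forall_exists_eLpNorm_sub_lt (hG : Integrable G μ)
    (hψ : MemLp ψ ∞ μ) (h : ∀ ε > 0, ∃ K : A → ℂ, Integrable K μ ∧ eLpNorm (K - G) 1 μ < ε ∧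
      Tendsto (K ⋆[lsmul ℂ ℂ, μ] ψ) l (𝓝 0)) :
    Tendsto (G ⋆[lsmul ℂ ℂ, μ] ψ) l (𝓝 0) := by
  rw [tendsto_zero_iff_enorm_tendsto_zero, ENNReal.tendsto_nhds_zero]
  intro ε hε
  have hε2 : 0 < ε / 2 := ENNReal.half_pos hε.ne'
  obtain ⟨K, hK, hKG, hKψ⟩ := h (ε / 2 / eLpNorm ψ ∞ μ) (ENNReal.div_pos hε2.ne' hψ.2.ne)
  rw [tendsto_zero_iff_enorm_tendsto_zero, ENNReal.tendsto_nhds_zero] at hKψ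
  have h_split : K ⋆[lsmul ℂ ℂ, μ] ψ = (K - G) ⋆[lsmul ℂ ℂ, μ] ψ + G ⋆[lsmul ℂ ℂ, μ] ψ := by
    rw [← ConvolutionExists.add_distrib
      (convolutionExists_of_integrable_of_memLp_top (hK.sub hG) hψ)
      (convolutionExists_of_integrable_of_memLp_top hG hψ), sub_add_cancel]
  filter_upwards [hKψ (ε / 2) hε2] with x hx
  calc ‖(G ⋆[lsmul ℂ ℂ, μ] ψ) x‖ₑ
      = ‖(K ⋆[lsmul ℂ ℂ, μ] ψ) x - ((K - G) ⋆[lsmul ℂ ℂ, μ] ψ) x‖ₑ := by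
        rw [h_split, Pi.add_apply, add_sub_cancel_left]
    _ ≤ ‖(K ⋆[lsmul ℂ ℂ, μ] ψ) x‖ₑ + ‖((K - G) ⋆[lsmul ℂ ℂ, μ] ψ) x‖ₑ := enorm_sub_le
    _ ≤ ε / 2 + ε / 2 := add_le_add hx
        ((enorm_convolution_le_eLpNorm_mul (hK.sub hG) hψ x).trans
          (ENNReal.mul_le_of_le_div hKG.le))
    _ = ε := ENNReal.add_halves ε

variable [SFinite μ]

theorem memLp_top_convolution (hF : Integrable F μ) (hψ : MemLp ψ ∞ μ) :
    MemLp (F ⋆[lsmul ℂ ℂ, μ] ψ) ∞ μ := by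
  refine ⟨(hF.1.convolution_integrand (lsmul ℂ ℂ) hψ.1).integral_prod_right', ?_⟩
  rw [eLpNorm_exponent_top]
  exact (eLpNormEssSup_le_of_ae_enorm_bound
    (.of_forall (enorm_convolution_le_eLpNorm_mul hF hψ))).trans_lt
    (ENNReal.mul_lt_top (memLp_one_iff_integrable.2 hF).2 hψ.2)

variable [CompleteSpace E]

theorem convolution_convolution_assoc (hF : Integrable F μ) (hG : Integrable G μ)
    (hψ : MemLp ψ ∞ μ) :
    (F ⋆[lsmul ℂ ℂ, μ] G) ⋆[lsmul ℂ ℂ, μ] ψ = F ⋆[lsmul ℂ ℂ, μ] G ⋆[lsmul ℂ ℂ, μ] ψ := by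
  ext x
  refine convolution_assoc' _ _ _ _ (fun a b v => mul_smul a b v) (hF.ae_convolution_exists _ hG)
    (.of_forall (convolutionExists_of_integrable_of_memLp_top hG hψ)) ?_
  have hψ' : MemLp (fun p : A × A => ψ (x - p.1)) ∞ (μ.prod μ) :=
    memLp_top_comp_of_quasiMeasurePreserving (memLp_top_comp_sub_left hψ x)
      Measure.quasiMeasurePreserving_fst
  refine ((hF.convolution_integrand (lsmul ℂ ℂ) hG).smul_of_top_left hψ').congr
    (.of_forall fun p => ?_)
  exact mul_smul (F p.2) (G (p.1 - p.2)) (ψ (x - p.1))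

theorem convolution_left_comm (hF : Integrable F μ) (hG : Integrable G μ)
    (hψ : MemLp ψ ∞ μ) :
    F ⋆[lsmul ℂ ℂ, μ] G ⋆[lsmul ℂ ℂ, μ] ψ = G ⋆[lsmul ℂ ℂ, μ] F ⋆[lsmul ℂ ℂ, μ] ψ := by
  rw [← convolution_convolution_assoc hF hG hψ, ← convolution_convolution_assoc hG hF hψ,
    convolution_lsmul_comm]

end BoundedConvolution

/-- The `L¹` modulus of continuity `y ↦ ‖G(· - y) - G‖₁` of a function on a group, as an extended
nonnegative real, so that it needs no integrability of `G`. -/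
noncomputable def translationModulus {A E : Type*} [AddGroup A] [MeasurableSpace A]
    [NormedAddCommGroup E] (μ : Measure A) (G : A → E) (y : A) : ℝ≥0∞ :=
  eLpNorm (fun z => G (z - y) - G z) 1 μ

section TranslationModulus

variable {A E : Type*} [AddCommGroup A] [MeasurableSpace A] {μ : Measure A}
  [NormedAddCommGroup E] {F : A → ℂ} {G : A → E}

theorem translationModulus_zero : translationModulus μ G 0 = 0 := by
  simp [translationModulus]

theorem translationModulus_le [MeasurableAdd A] [μ.IsAddLeftInvariant]
    (hG : AEStronglyMeasurable G μ) (y : A) : translationModulus μ G y ≤ 2 * eLpNorm G 1 μ := by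
  have hy := measurePreserving_sub_right μ y
  calc translationModulus μ G y
      ≤ eLpNorm (G ∘ (· - y)) 1 μ + eLpNorm G 1 μ :=
        eLpNorm_sub_le (hG.comp_measurePreserving hy) hG le_rfl
    _ = 2 * eLpNorm G 1 μ := by rw [eLpNorm_comp_measurePreserving hG hy, two_mul]

theorem continuous_translationModulus [TopologicalSpace A] [IsTopologicalAddGroup A]
    [BorelSpace A] [IsLocallyFiniteMeasure μ] [μ.InnerRegularCompactLTTop]
    [μ.IsAddLeftInvariant] (hG : Integrable G μ) : Continuous (translationModulus μ G) := by
  have hG1 : MemLp G 1 μ := memLp_one_iff_integrable.2 hG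
  have : Fact ((1 : ℝ≥0∞) ≠ ∞) := ⟨ENNReal.one_ne_top⟩
  have h_mk : Continuous fun y : A => DomAddAct.mk (-y) := by fun_prop
  have h_edist : Continuous fun y : A => edist (DomAddAct.mk (-y) +ᵥ hG1.toLp G) (hG1.toLp G) :=
    (h_mk.vadd continuous_const).edist continuous_const
  refine h_edist.congr fun y => ?_
  rw [DomAddAct.mk_vadd_toLp, Lp.edist_toLp_toLp]
  simp only [translationModulus, vadd_eq_add, neg_add_eq_sub]
  rfl

theorem eLpNorm_convolution_sub_integral_smul_le [MeasurableAdd₂ A] [MeasurableNeg A] [SFinite μ]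
    [μ.IsAddLeftInvariant] [NormedSpace ℂ E] [CompleteSpace E] (hF : Integrable F μ)
    (hG : Integrable G μ) :
    eLpNorm (F ⋆[lsmul ℂ ℂ, μ] G - (∫ y, F y ∂μ) • G) 1 μ ≤
      ∫⁻ y, ‖F y‖ₑ * translationModulus μ G y ∂μ := by
  have h_meas : AEStronglyMeasurable (fun p : A × A => F p.2 • (G (p.1 - p.2) - G p.1))
      (μ.prod μ) := by
    simp_rw [smul_sub]
    exact (hF.1.convolution_integrand (lsmul ℂ ℂ) hG.1).sub (hF.1.comp_snd.smul hG.1.comp_fst)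
  have h_eq : ∀ᵐ z ∂μ, (F ⋆[lsmul ℂ ℂ, μ] G - (∫ y, F y ∂μ) • G) z =
      ∫ y, F y • (G (z - y) - G z) ∂μ := by
    filter_upwards [hF.ae_convolution_exists (lsmul ℂ ℂ) hG] with z hz
    have hz : Integrable (fun y => F y • G (z - y)) μ := hz
    have h_const : Integrable (fun y => F y • G z) μ := hF.smul_const _
    simp_rw [smul_sub, integral_sub hz h_const, integral_smul_const]
    rfl
  calc eLpNorm (F ⋆[lsmul ℂ ℂ, μ] G - (∫ y, F y ∂μ) • G) 1 μ
      = ∫⁻ z, ‖∫ y, F y • (G (z - y) - G z) ∂μ‖ₑ ∂μ := by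
        rw [eLpNorm_congr_ae h_eq, eLpNorm_one_eq_lintegral_enorm]
    _ ≤ ∫⁻ z, ∫⁻ y, ‖F y • (G (z - y) - G z)‖ₑ ∂μ ∂μ :=
        lintegral_mono fun z => enorm_integral_le_lintegral_enorm _
    _ = ∫⁻ y, ∫⁻ z, ‖F y • (G (z - y) - G z)‖ₑ ∂μ ∂μ := lintegral_lintegral_swap h_meas.enorm
    _ = ∫⁻ y, ‖F y‖ₑ * translationModulus μ G y ∂μ := by
        simp only [enorm_smul, translationModulus, eLpNorm_one_eq_lintegral_enorm,
          lintegral_const_mul' _ _ enorm_ne_top]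

end TranslationModulus

section Dilation

variable {V E : Type*} [NormedAddCommGroup V] [NormedSpace ℝ V] [FiniteDimensional ℝ V]
  [MeasurableSpace V] [BorelSpace V] {μ : Measure V} [μ.IsAddHaarMeasure]
  [NormedAddCommGroup E] {F : V → ℂ} {G : V → E}

theorem tendsto_lintegral_enorm_mul_translationModulus (hF : Integrable F μ)
    (hG : Integrable G μ) :
    Tendsto (fun s : ℝ => ∫⁻ y, ‖F y‖ₑ * translationModulus μ G (s • y) ∂μ) (𝓝 0) (𝓝 0) := by
  have hc := continuous_translationModulus hG
  have h_lim (y : V) :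
      Tendsto (fun s : ℝ => ‖F y‖ₑ * translationModulus μ G (s • y)) (𝓝 0) (𝓝 0) := by
    have : Tendsto (fun s : ℝ => translationModulus μ G (s • y)) (𝓝 0) (𝓝 0) := by
      have hcy : Continuous fun s : ℝ => translationModulus μ G (s • y) := by fun_prop
      simpa only [zero_smul, translationModulus_zero] using hcy.tendsto 0
    simpa using ENNReal.Tendsto.const_mul this (.inr enorm_ne_top)
  have h_fin : ∫⁻ y, ‖F y‖ₑ * (2 * eLpNorm G 1 μ) ∂μ ≠ ∞ := by
    rw [lintegral_enorm_mul_const hF.1]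
    exact ENNReal.mul_ne_top (memLp_one_iff_integrable.2 hF).2.ne
      (ENNReal.mul_ne_top ENNReal.ofNat_ne_top (memLp_one_iff_integrable.2 hG).2.ne)
  simpa using tendsto_lintegral_filter_of_dominated_convergence' (μ := μ) (f := fun _ => 0)
    (fun y => ‖F y‖ₑ * (2 * eLpNorm G 1 μ))
    (.of_forall fun s => hF.1.enorm.mul (hc.comp (continuous_const_smul s)).measurable.aemeasurable)
    (.of_forall fun s => .of_forall fun y => mul_right_mono (translationModulus_le hG.1 (s • y)))
    h_fin (.of_forall h_lim)

theorem exists_pos_lintegral_enorm_mul_translationModulus_lt (hF : Integrable F μ)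
    (hG : Integrable G μ) {ε : ℝ≥0∞} (hε : 0 < ε) :
    ∃ s > 0, ∫⁻ y, ‖F y‖ₑ * translationModulus μ G ((s : ℝ) • y) ∂μ < ε := by
  have h := (tendsto_lintegral_enorm_mul_translationModulus hF hG).eventually (gt_mem_nhds hε)
  obtain ⟨s, hs, hs0⟩ := ((h.filter_mono nhdsWithin_le_nhds).and
    (self_mem_nhdsWithin (s := Set.Ioi 0))).exists
  exact ⟨s, hs0, hs⟩

end Dilation

section Rescale

variable {V : Type*} [NormedAddCommGroup V] [NormedSpace ℝ V]

/-- The `L¹`-normalized dilation `x ↦ aⁿ κ(a x)` of a kernel on an `n`-dimensional space; it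
concentrates at the origin as `a → ∞` and spreads out as `a → 0`. -/
noncomputable def rescale (a : ℝ) (κ : V → ℂ) (x : V) : ℂ := a ^ Module.finrank ℝ V • κ (a • x)

variable [FiniteDimensional ℝ V] [MeasurableSpace V] [BorelSpace V] (μ : Measure V)
  [μ.IsAddHaarMeasure] {a : ℝ}

theorem lintegral_pow_finrank_mul_comp_smul (ha : 0 < a) (h : V → ℝ≥0∞) :
    ∫⁻ x, ENNReal.ofReal (a ^ Module.finrank ℝ V) * h (a • x) ∂μ = ∫⁻ x, h x ∂μ := by
  have h_pow : 0 < a ^ Module.finrank ℝ V := by positivity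
  let e : V ≃ᵐ V := (Homeomorph.smulOfNeZero a ha.ne').toMeasurableEquiv
  have h_map : Measure.map e μ = ENNReal.ofReal (a ^ Module.finrank ℝ V)⁻¹ • μ :=
    (Measure.map_addHaar_smul μ ha.ne').trans (by rw [abs_of_pos (inv_pos.2 h_pow)])
  calc ∫⁻ x, ENNReal.ofReal (a ^ Module.finrank ℝ V) * h (a • x) ∂μ
      = ENNReal.ofReal (a ^ Module.finrank ℝ V) * ∫⁻ x, h x ∂(Measure.map e μ) := by
        rw [lintegral_const_mul' _ _ ENNReal.ofReal_ne_top, lintegral_map_equiv]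
        rfl
    _ = ∫⁻ x, h x ∂μ := by
        rw [h_map, lintegral_smul_measure, smul_eq_mul, ← mul_assoc, ← ENNReal.ofReal_mul h_pow.le,
          mul_inv_cancel₀ h_pow.ne', ENNReal.ofReal_one, one_mul]

theorem lintegral_enorm_rescale_mul (ha : 0 < a) (κ : V → ℂ) (h : V → ℝ≥0∞) :
    ∫⁻ y, ‖rescale a κ y‖ₑ * h y ∂μ = ∫⁻ y, ‖κ y‖ₑ * h (a⁻¹ • y) ∂μ := by
  rw [← lintegral_pow_finrank_mul_comp_smul μ ha fun y => ‖κ y‖ₑ * h (a⁻¹ • y)]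
  simp only [rescale, enorm_smul, inv_smul_smul₀ ha.ne', mul_assoc,
    Real.enorm_of_nonneg (pow_nonneg ha.le _)]

theorem translationModulus_rescale (ha : 0 < a) (κ : V → ℂ) (y : V) :
    translationModulus μ (rescale a κ) y = translationModulus μ κ (a • y) := by
  have h_smul (z : V) : ‖rescale a κ (z - y) - rescale a κ z‖ₑ =
      ENNReal.ofReal (a ^ Module.finrank ℝ V) * ‖κ (a • z - a • y) - κ (a • z)‖ₑ := by
    rw [rescale, rescale, ← smul_sub, enorm_smul, Real.enorm_of_nonneg (by positivity),
      smul_sub a z y]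
  simp only [translationModulus, eLpNorm_one_eq_lintegral_enorm, h_smul]
  exact lintegral_pow_finrank_mul_comp_smul μ ha fun z => ‖κ (z - a • y) - κ z‖ₑ

end Rescale

section Plateau

variable {V : Type*} [NormedAddCommGroup V] [InnerProductSpace ℝ V] [FiniteDimensional ℝ V]

/-- A smooth bump with value `1` on the ball of radius `a` around `η` and support in the ball of
radius `2a`. -/
noncomputable def plateauBump (η : V) {a : ℝ} (ha : 0 < a) : ContDiffBump η where
  rIn := a
  rOut := 2 * a
  rIn_pos := ha
  rIn_lt_rOut := by linarith

theorem plateauBump_eq_comp_smul (η : V) {a : ℝ} (ha : 0 < a) (ξ : V) :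
    plateauBump η ha ξ = plateauBump (0 : V) one_pos (a⁻¹ • (ξ - η)) := by
  simp [plateauBump, ContDiffBump.apply, ha.ne']

theorem hasCompactSupport_ofReal_plateauBump (η : V) {a : ℝ} (ha : 0 < a) :
    HasCompactSupport fun ξ => (plateauBump η ha ξ : ℂ) :=
  (plateauBump η ha).hasCompactSupport.comp_left Complex.ofReal_zero

/-- `plateauBump` as a complex-valued Schwartz function. -/
noncomputable def plateau (η : V) {a : ℝ} (ha : 0 < a) : 𝓢(V, ℂ) :=
  (hasCompactSupport_ofReal_plateauBump η ha).toSchwartzMap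
    (Complex.ofRealCLM.contDiff.comp (plateauBump η ha).contDiff)

variable (η : V) {a : ℝ} (ha : 0 < a)

theorem plateau_apply (ξ : V) : plateau η ha ξ = plateauBump η ha ξ := rfl

theorem plateau_eq_one {ξ : V} (hξ : ξ ∈ Metric.closedBall η a) : plateau η ha ξ = 1 := by
  rw [plateau_apply, (plateauBump η ha).one_of_mem_closedBall hξ, Complex.ofReal_one]

theorem hasCompactSupport_plateau : HasCompactSupport (plateau η ha) :=
  hasCompactSupport_ofReal_plateauBump η ha

variable [MeasurableSpace V] [BorelSpace V]

/-- The band-limited kernel whose Fourier transform is the plateau around `η` of radius `a`. -/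
noncomputable def plateauKernel : 𝓢(V, ℂ) := 𝓕⁻ (plateau η ha)

theorem fourier_plateauKernel : 𝓕 (plateauKernel η ha) = plateau η ha :=
  FourierTransform.fourier_fourierInv_eq _

theorem plateauKernel_apply (x : V) :
    plateauKernel η ha x = 𝐞 ⟪η, x⟫ • rescale a (plateauKernel 0 one_pos) x :=
  calc plateauKernel η ha x
      = ∫ ξ, 𝐞 ⟪ξ, x⟫ • plateau 0 one_pos (a⁻¹ • (ξ - η)) := by
        rw [plateauKernel, SchwartzMap.fourierInv_coe, Real.fourierInv_eq]
        simp_rw [plateau_apply, plateauBump_eq_comp_smul η ha]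
    _ = ∫ ξ, 𝐞 ⟪η + ξ, x⟫ • plateau 0 one_pos (a⁻¹ • ξ) := by
        rw [← integral_add_left_eq_self _ η]
        simp only [add_sub_cancel_left]
    _ = a ^ Module.finrank ℝ V • ∫ ξ, 𝐞 ⟪η + a • ξ, x⟫ • plateau (0 : V) one_pos ξ := by
        rw [← Measure.integral_comp_inv_smul_of_nonneg _ _ ha.le]
        simp only [smul_inv_smul₀ ha.ne']
    _ = 𝐞 ⟪η, x⟫ • rescale a (plateauKernel 0 one_pos) x := by
        rw [rescale, plateauKernel, SchwartzMap.fourierInv_coe, Real.fourierInv_eq]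
        simp only [inner_add_left, real_inner_smul_left, real_inner_smul_right,
          AddChar.map_add_eq_mul, mul_smul, Circle.smul_def, integral_smul]
        rw [smul_comm]

end Plateau

section BandLimited

variable {V : Type*} [NormedAddCommGroup V] [InnerProductSpace ℝ V] [FiniteDimensional ℝ V]
  [MeasurableSpace V] [BorelSpace V]

theorem exists_eLpNorm_plateauKernel_convolution_sub_lt {G : V → ℂ} (hG : Integrable G)
    {ε : ℝ≥0∞} (hε : 0 < ε) :
    ∃ (a : ℝ) (ha : 0 < a),
      eLpNorm (plateauKernel 0 ha ⋆[lsmul ℂ ℂ] G - G) 1 volume < ε := by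
  obtain ⟨s, hs, hsε⟩ := exists_pos_lintegral_enorm_mul_translationModulus_lt
    (plateauKernel (0 : V) one_pos).integrable hG hε
  refine ⟨s⁻¹, inv_pos.2 hs, lt_of_le_of_lt ?_ hsε⟩
  have h_apply (y : V) : plateauKernel (0 : V) (inv_pos.2 hs) y =
      rescale s⁻¹ (plateauKernel (0 : V) one_pos) y := by
    rw [plateauKernel_apply, inner_zero_left, AddChar.map_zero_eq_one, one_smul]
  have h_integral : ∫ y, plateauKernel (0 : V) (inv_pos.2 hs) y = 1 := by
    have := plateau_eq_one (0 : V) (inv_pos.2 hs) (Metric.mem_closedBall_self (inv_pos.2 hs).le)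
    rw [← fourier_plateauKernel, SchwartzMap.fourier_coe, Real.fourier_eq] at this
    simpa using this
  calc eLpNorm (plateauKernel (0 : V) (inv_pos.2 hs) ⋆[lsmul ℂ ℂ] G - G) 1 volume
      ≤ ∫⁻ y, ‖plateauKernel (0 : V) (inv_pos.2 hs) y‖ₑ * translationModulus volume G y := by
        simpa only [h_integral, one_smul] using eLpNorm_convolution_sub_integral_smul_le
          (plateauKernel (0 : V) (inv_pos.2 hs)).integrable hG
    _ = ∫⁻ y, ‖plateauKernel (0 : V) one_pos y‖ₑ * translationModulus volume G (s • y) := by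
        simp_rw [h_apply, lintegral_enorm_rescale_mul volume (inv_pos.2 hs), inv_inv]

theorem convolution_modulate (η : V) (F κ : V → ℂ) (z : V) :
    (F ⋆[lsmul ℂ ℂ] fun y => 𝐞 ⟪η, y⟫ • κ y) z =
      𝐞 ⟪η, z⟫ • ((fun y => 𝐞 (-⟪y, η⟫) • F y) ⋆[lsmul ℂ ℂ] κ) z := by
  simp only [convolution_lsmul, Circle.smul_def, smul_eq_mul, ← integral_const_mul]
  refine integral_congr_ae (.of_forall fun y => ?_)
  beta_reduce
  rw [inner_sub_right, AddChar.map_sub_eq_div, AddChar.map_neg_eq_inv, real_inner_comm η y]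
  push_cast
  ring

theorem exists_eLpNorm_convolution_plateauKernel_sub_lt {F : V → ℂ} (hF : Integrable F) (η : V)
    {ε : ℝ≥0∞} (hε : 0 < ε) :
    ∃ (a : ℝ) (ha : 0 < a), eLpNorm (F ⋆[lsmul ℂ ℂ] plateauKernel η ha -
      𝓕 F η • ⇑(plateauKernel η ha)) 1 volume < ε := by
  let κ : V → ℂ := plateauKernel 0 one_pos
  obtain ⟨a, ha, haε⟩ := exists_pos_lintegral_enorm_mul_translationModulus_lt hF
    (plateauKernel (0 : V) one_pos).integrable hε
  refine ⟨a, ha, lt_of_le_of_lt ?_ haε⟩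
  let F' : V → ℂ := fun y => 𝐞 (-⟪y, η⟫) • F y
  have hF' : Integrable F' := (Real.fourierIntegral_convergent_iff η).2 hF
  have hκ' : Integrable (rescale a κ) :=
    ((plateauKernel (0 : V) one_pos).integrable.comp_smul ha.ne').smul (a ^ Module.finrank ℝ V)
  have h_apply : ⇑(plateauKernel η ha) = fun y => 𝐞 ⟪η, y⟫ • rescale a κ y :=
    funext (plateauKernel_apply η ha)
  calc eLpNorm (F ⋆[lsmul ℂ ℂ] plateauKernel η ha - 𝓕 F η • ⇑(plateauKernel η ha)) 1 volume
      = eLpNorm (F' ⋆[lsmul ℂ ℂ] rescale a κ - (∫ y, F' y) • rescale a κ) 1 volume := by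
        refine eLpNorm_congr_norm_ae (.of_forall fun z => ?_)
        simp only [h_apply, Pi.sub_apply, Pi.smul_apply, convolution_modulate, F', Real.fourier_eq]
        rw [smul_comm, ← smul_sub, Circle.norm_smul]
    _ ≤ ∫⁻ y, ‖F' y‖ₑ * translationModulus volume (rescale a κ) y :=
        eLpNorm_convolution_sub_integral_smul_le hF' hκ'
    _ = ∫⁻ y, ‖F y‖ₑ * translationModulus volume κ (a • y) := by
        have h_enorm (y : V) : ‖F' y‖ₑ = ‖F y‖ₑ := enorm_eq_iff_norm_eq.2 (Circle.norm_smul _ _)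
        simp_rw [h_enorm, translationModulus_rescale volume ha]

end BandLimited

theorem disjoint_tsupport_of_eventually_nhdsSet_eq_zero {X M : Type*} [TopologicalSpace X] [Zero M]
    {f : X → M} {s : Set X} (h : ∀ᶠ x in 𝓝ˢ s, f x = 0) : Disjoint s (tsupport f) :=
  Set.disjoint_left.2 fun _ hx =>
    notMem_tsupport_iff_eventuallyEq.2 (h.filter_mono (nhds_le_nhdsSet hx))

theorem exists_schwartzMap_add_of_tsupport_subset_union {V : Type*} [NormedAddCommGroup V]
    [NormedSpace ℝ V] [FiniteDimensional ℝ V] {U W : Set V} (hU : IsOpen U) (hW : IsOpen W)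
    {w : 𝓢(V, ℂ)} (hw : HasCompactSupport w) (hUW : tsupport w ⊆ U ∪ W) :
    ∃ w₁ w₂ : 𝓢(V, ℂ), w = w₁ + w₂ ∧ (HasCompactSupport w₁ ∧ tsupport w₁ ⊆ U) ∧
      HasCompactSupport w₂ ∧ tsupport w₂ ⊆ W := by
  have h_disj : Disjoint Uᶜ (tsupport w \ W) :=
    Set.disjoint_left.2 fun ξ hξ hξ' => (hUW hξ'.1).elim hξ hξ'.2
  obtain ⟨b, hb, hb0, hb1⟩ : ∃ b : V → ℝ, ContDiff ℝ (⊤ : ℕ∞) b ∧ (∀ᶠ ξ in 𝓝ˢ Uᶜ, b ξ = 0) ∧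
      ∀ᶠ ξ in 𝓝ˢ (tsupport w \ W), 1 - b ξ = 0 := by
    obtain ⟨b, hb0, hb1, -⟩ := exists_contMDiffMap_zero_one_nhds_of_isClosed (n := (⊤ : ℕ∞))
      (modelWithCornersSelf ℝ V) hU.isClosed_compl ((isClosed_tsupport w).sdiff hW) h_disj
    exact ⟨b, b.contMDiff.contDiff, hb0, hb1.mono fun ξ hξ => sub_eq_zero.2 hξ.symm⟩
  have hw₁ : HasCompactSupport fun ξ => b ξ • w ξ := HasCompactSupport.smul_left (R := ℝ) hw
  have hw₂ : HasCompactSupport fun ξ => (1 - b ξ) • w ξ := HasCompactSupport.smul_left (R := ℝ) hw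
  refine ⟨hw₁.toSchwartzMap (hb.smul (w.smooth ⊤)),
    hw₂.toSchwartzMap ((contDiff_const.sub hb).smul (w.smooth ⊤)), ?_, ⟨hw₁, fun ξ hξ => ?_⟩,
    hw₂, fun ξ hξ => ?_⟩
  · ext ξ
    exact (by module : w ξ = b ξ • w ξ + (1 - b ξ) • w ξ)
  · by_contra hξU
    exact (disjoint_tsupport_of_eventually_nhdsSet_eq_zero hb0).notMem_of_mem_left hξU
      (tsupport_smul_subset_left b w hξ)
  · by_contra hξW
    exact (disjoint_tsupport_of_eventually_nhdsSet_eq_zero hb1).notMem_of_mem_left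
      ⟨tsupport_smul_subset_right (fun ξ => 1 - b ξ) w hξ, hξW⟩
      (tsupport_smul_subset_left (fun ξ => 1 - b ξ) w hξ)

theorem schwartzMap_induction_of_hasCompactSupport {V : Type*} [NormedAddCommGroup V]
    [NormedSpace ℝ V] [FiniteDimensional ℝ V] {p : 𝓢(V, ℂ) → Prop} {w : 𝓢(V, ℂ)}
    (hw : HasCompactSupport w) (h_zero : p 0) (h_add : ∀ v₁ v₂, p v₁ → p v₂ → p (v₁ + v₂))
    (h_local : ∀ ξ, ∃ U ∈ 𝓝 ξ, ∀ v : 𝓢(V, ℂ), tsupport v ⊆ U → p v) : p w := by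
  obtain ⟨U, -, hwU, hU⟩ : ∃ U, IsOpen U ∧ tsupport w ⊆ U ∧
      ∀ v : 𝓢(V, ℂ), HasCompactSupport v → tsupport v ⊆ U → p v := by
    refine hw.isCompact.induction_on (p := fun s => ∃ U, IsOpen U ∧ s ⊆ U ∧
      ∀ v : 𝓢(V, ℂ), HasCompactSupport v → tsupport v ⊆ U → p v) ?empty ?mono ?union ?nhds
    case empty =>
      refine ⟨∅, isOpen_empty, subset_rfl, fun v _ hv => ?_⟩
      rwa [show v = 0 from
        DFunLike.coe_injective (tsupport_eq_empty_iff.1 (Set.subset_empty_iff.1 hv))]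
    case mono =>
      rintro s t hst ⟨U, hU, htU, hpU⟩
      exact ⟨U, hU, hst.trans htU, hpU⟩
    case union =>
      rintro s t ⟨U, hU, hsU, hpU⟩ ⟨W, hW, htW, hpW⟩
      refine ⟨U ∪ W, hU.union hW, Set.union_subset_union hsU htW, fun v hv hvUW => ?_⟩
      obtain ⟨v₁, v₂, rfl, ⟨hv₁, hv₁U⟩, hv₂, hv₂W⟩ :=
        exists_schwartzMap_add_of_tsupport_subset_union hU hW hv hvUW
      exact h_add v₁ v₂ (hpU v₁ hv₁ hv₁U) (hpW v₂ hv₂ hv₂W)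
    case nhds =>
      intro ξ _
      obtain ⟨U, hUξ, hpU⟩ := h_local ξ
      exact ⟨interior U, mem_nhdsWithin_of_mem_nhds (interior_mem_nhds.2 hUξ), interior U,
        isOpen_interior, subset_rfl, fun v _ hv => hpU v (hv.trans interior_subset)⟩
  exact hU w hw hwU

section Wiener
variable {V : Type*} [NormedAddCommGroup V] [InnerProductSpace ℝ V] [FiniteDimensional ℝ V]
  [MeasurableSpace V] [BorelSpace V]

theorem fourierInv_convolution_eq_right {v w : 𝓢(V, ℂ)} (h : ∀ ξ ∈ tsupport w, v ξ = 1) :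
    (𝓕⁻ v : 𝓢(V, ℂ)) ⋆[lsmul ℂ ℂ] (𝓕⁻ w : 𝓢(V, ℂ)) = (𝓕⁻ w : 𝓢(V, ℂ)) := by
  have h_fourier :
      𝓕 (SchwartzMap.convolution (lsmul ℂ ℂ) (𝓕⁻ v) (𝓕⁻ w)) = 𝓕 (𝓕⁻ w : 𝓢(V, ℂ)) := by
    ext ξ
    rw [SchwartzMap.fourier_convolution, SchwartzMap.pairing_apply_apply,
      FourierTransform.fourier_fourierInv_eq, FourierTransform.fourier_fourierInv_eq]
    by_cases hξ : ξ ∈ tsupport w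
    · simp [h ξ hξ]
    · simp [image_eq_zero_of_notMem_tsupport hξ]
  have h_conv := congrArg 𝓕⁻ h_fourier
  rw [FourierTransform.fourierInv_fourier_eq, FourierTransform.fourierInv_fourier_eq] at h_conv
  ext x
  rw [← SchwartzMap.convolution_apply, h_conv]

variable {E : Type*} [NormedAddCommGroup E] [NormedSpace ℂ E] [CompleteSpace E] {F G : V → ℂ}
  {ψ : V → E} {l : Filter V} [l.IsCountablyGenerated]

theorem exists_ball_tendsto_convolution_of_fourier_ne_zero (hl : ∀ y, Tendsto (· - y) l l)
    (hF : Integrable F) (hψ : MemLp ψ ∞) (h : Tendsto (F ⋆[lsmul ℂ ℂ] ψ) l (𝓝 0)) {η : V}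
    (hη : 𝓕 F η ≠ 0) :
    ∃ a > 0, ∀ w : 𝓢(V, ℂ), tsupport w ⊆ Metric.ball η a →
      Tendsto ((𝓕⁻ w : 𝓢(V, ℂ)) ⋆[lsmul ℂ ℂ] ψ) l (𝓝 0) := by
  obtain ⟨a, ha, h_lt⟩ := exists_eLpNorm_convolution_plateauKernel_sub_lt hF η (enorm_pos.2 hη)
  refine ⟨a, ha, fun w hw => ?_⟩
  let k := plateauKernel η ha
  let u : 𝓢(V, ℂ) := 𝓕⁻ w
  have hk : Integrable k := k.integrable
  have hu : Integrable u := u.integrable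
  have hθ : MemLp (u ⋆[lsmul ℂ ℂ] ψ) ∞ := memLp_top_convolution hu hψ
  set D := F ⋆[lsmul ℂ ℂ] k - 𝓕 F η • ⇑k with hD_def
  have hD : Integrable D := (hF.integrable_convolution _ hk).sub (hk.smul _)
  have h_reproduce : k ⋆[lsmul ℂ ℂ] (u ⋆[lsmul ℂ ℂ] ψ) = u ⋆[lsmul ℂ ℂ] ψ := by
    have h_ku : k ⋆[lsmul ℂ ℂ] u = u := fourierInv_convolution_eq_right fun ξ hξ =>
      plateau_eq_one η ha (Metric.ball_subset_closedBall (hw hξ))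
    rw [← convolution_convolution_assoc hk hu hψ, h_ku]
  have h_decomp : D ⋆[lsmul ℂ ℂ] (u ⋆[lsmul ℂ ℂ] ψ) + 𝓕 F η • (u ⋆[lsmul ℂ ℂ] ψ) =
      F ⋆[lsmul ℂ ℂ] (u ⋆[lsmul ℂ ℂ] ψ) :=
    calc _ = (D + 𝓕 F η • ⇑k) ⋆[lsmul ℂ ℂ] (u ⋆[lsmul ℂ ℂ] ψ) := by
          rw [ConvolutionExists.add_distrib (convolutionExists_of_integrable_of_memLp_top hD hθ)
            (convolutionExists_of_integrable_of_memLp_top (hk.smul _) hθ), smul_convolution,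
            h_reproduce]
      _ = F ⋆[lsmul ℂ ℂ] (u ⋆[lsmul ℂ ℂ] ψ) := by
          rw [hD_def, sub_add_cancel, convolution_convolution_assoc hF hk hθ, h_reproduce]
  have h_bdd : limsup (fun x => ‖(u ⋆[lsmul ℂ ℂ] ψ) x‖ₑ) l ≠ ∞ :=
    ((limsup_le_iSup.trans (iSup_le (enorm_convolution_le_eLpNorm_mul hu hψ))).trans_lt
      (ENNReal.mul_lt_top (memLp_one_iff_integrable.2 hu).2 hψ.2)).ne
  refine tendsto_zero_of_tendsto_convolution_add_smul hl hD hθ h_bdd h_lt ?_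
  rw [h_decomp, convolution_left_comm hF hu hψ]
  exact tendsto_convolution_zero hl hu (memLp_top_convolution hF hψ) h

theorem tendsto_fourierInv_convolution_of_hasCompactSupport (hl : ∀ y, Tendsto (· - y) l l)
    (hF : Integrable F) (hF0 : ∀ η, 𝓕 F η ≠ 0) (hψ : MemLp ψ ∞)
    (h : Tendsto (F ⋆[lsmul ℂ ℂ] ψ) l (𝓝 0)) {w : 𝓢(V, ℂ)} (hw : HasCompactSupport w) :
    Tendsto ((𝓕⁻ w : 𝓢(V, ℂ)) ⋆[lsmul ℂ ℂ] ψ) l (𝓝 0) := by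
  refine schwartzMap_induction_of_hasCompactSupport hw ?zero ?add fun η =>
    let ⟨a, ha, h_ball⟩ := exists_ball_tendsto_convolution_of_fourier_ne_zero hl hF hψ h (hF0 η)
    ⟨Metric.ball η a, Metric.ball_mem_nhds η ha, h_ball⟩
  case zero =>
    rw [FourierTransform.fourierInv_zero]
    exact tendsto_const_nhds.congr fun x => (congrFun zero_convolution x).symm
  case add =>
    intro v₁ v₂ h₁ h₂
    rw [FourierTransform.fourierInv_add, FunLike.coe_add, ConvolutionExists.add_distrib
      (convolutionExists_of_integrable_of_memLp_top (SchwartzMap.integrable _) hψ)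
      (convolutionExists_of_integrable_of_memLp_top (SchwartzMap.integrable _) hψ)]
    have h_sum := h₁.add h₂
    rwa [add_zero] at h_sum

theorem wiener_tauberian (hl : ∀ y, Tendsto (· - y) l l)
    (hF : Integrable F) (hF0 : ∀ η, 𝓕 F η ≠ 0) (hψ : MemLp ψ ∞)
    (h : Tendsto (F ⋆[lsmul ℂ ℂ] ψ) l (𝓝 0)) (hG : Integrable G) :
    Tendsto (G ⋆[lsmul ℂ ℂ] ψ) l (𝓝 0) := by
  refine tendsto_convolution_zero_of_forall_exists_eLpNorm_sub_lt hG hψ fun ε hε => ?_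
  obtain ⟨a, ha, h_approx⟩ := exists_eLpNorm_plateauKernel_convolution_sub_lt hG hε
  have hk : Integrable (plateauKernel (0 : V) ha) := (plateauKernel 0 ha).integrable
  refine ⟨_, hk.integrable_convolution _ hG, h_approx, ?_⟩
  rw [convolution_convolution_assoc hk hG hψ, convolution_left_comm hk hG hψ]
  exact tendsto_convolution_zero hl hG (memLp_top_convolution hk hψ)
    (tendsto_fourierInv_convolution_of_hasCompactSupport hl hF hF0 hψ h
      (hasCompactSupport_plateau 0 ha))

end Wiener

section LogarithmicCoordinates

theorem integrableOn_Ioi_iff_integrable_exp {E : Type*} [NormedAddCommGroup E] [NormedSpace ℝ E]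
    {K : ℝ → E} :
    IntegrableOn K (Set.Ioi 0) ↔ Integrable fun u => Real.exp u • K (Real.exp u) := by
  rw [← Real.range_exp, ← Set.image_univ,
    integrableOn_image_iff_integrableOn_abs_deriv_smul MeasurableSet.univ
      (fun u _ => (Real.hasDerivAt_exp u).hasDerivWithinAt) Real.exp_injective.injOn]
  simp only [Real.abs_exp, integrableOn_univ]

theorem integral_Ioi_eq_integral_exp {E : Type*} [NormedAddCommGroup E] [NormedSpace ℝ E]
    (K : ℝ → E) : ∫ t in Set.Ioi 0, K t = ∫ u, Real.exp u • K (Real.exp u) := by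
  rw [← Real.range_exp, ← Set.image_univ,
    integral_image_eq_integral_abs_deriv_smul MeasurableSet.univ
      (fun u _ => (Real.hasDerivAt_exp u).hasDerivWithinAt) Real.exp_injective.injOn]
  simp only [Real.abs_exp, Measure.restrict_univ]

theorem integral_eq_integral_Ioi_neg_add {E : Type*} [NormedAddCommGroup E] [NormedSpace ℝ E]
    {K : ℝ → E} (hK : Integrable K) : ∫ t, K t = ∫ t in Set.Ioi 0, (K (-t) + K t) := by
  rw [integral_add hK.comp_neg.integrableOn hK.integrableOn, integral_comp_neg_Ioi, neg_zero,
    intervalIntegral.integral_Iic_add_Ioi hK.integrableOn hK.integrableOn]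

theorem quasiMeasurePreserving_exp :
    Measure.QuasiMeasurePreserving Real.exp (volume : Measure ℝ) volume := by
  refine ⟨Real.measurable_exp, Measure.AbsolutelyContinuous.mk fun s hs hs0 => ?_⟩
  rw [Measure.map_apply Real.measurable_exp hs]
  have h_image : volume (Real.log '' (s ∩ Set.Ioi 0)) = 0 :=
    addHaar_image_eq_zero_of_differentiableOn_of_addHaar_eq_zero volume
      (fun t ht => (Real.differentiableAt_log (ne_of_gt ht.2)).differentiableWithinAt)
      (measure_mono_null Set.inter_subset_left hs0)
  refine measure_mono_null (fun u hu => ?_) h_image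
  exact ⟨Real.exp u, ⟨hu, Real.exp_pos u⟩, Real.log_exp u⟩

theorem isEvenAE_dilate {f : ℝ → ℝ} (hf : IsEvenAE f) {r : ℝ} (hr : r ≠ 0) :
    IsEvenAE (dilate f r) := by
  have h_div : Measure.QuasiMeasurePreserving (· / r) (volume : Measure ℝ) volume := by
    simp only [div_eq_mul_inv]
    refine ⟨measurable_mul_const r⁻¹, ?_⟩
    rw [Real.map_volume_mul_right (inv_ne_zero hr)]
    exact Measure.smul_absolutelyContinuous
  filter_upwards [h_div.ae hf] with t ht
  simp only [dilate, neg_div, ht]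

theorem integrable_dilate {f : ℝ → ℝ} (hf : Integrable f) {r : ℝ} (hr : r ≠ 0) :
    Integrable (dilate f r) :=
  (hf.comp_div hr).const_mul r⁻¹

theorem integral_dilate (f : ℝ → ℝ) {r : ℝ} (hr : 0 < r) : ∫ t, dilate f r t = ∫ t, f t := by
  simp only [dilate]
  rw [integral_const_mul, Measure.integral_comp_div, abs_of_pos hr, smul_eq_mul,
    inv_mul_cancel_left₀ hr.ne']

/-- The kernel on the additive group `ℝ` that corresponds to `f` under the logarithm: convolving
with it amounts to averaging against the dilates of `f` on `(0, ∞)`. -/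
noncomputable def logKernel (f : ℝ → ℝ) (u : ℝ) : ℂ :=
  Real.exp (-u) • (f (Real.exp (-u)) : ℂ)

theorem integrable_logKernel {f : ℝ → ℝ} (hf : Integrable f) : Integrable (logKernel f) :=
  (integrableOn_Ioi_iff_integrable_exp.1 (hf.ofReal (𝕜 := ℂ)).integrableOn).comp_neg

theorem fourier_logKernel (f : ℝ → ℝ) (η : ℝ) : 𝓕 (logKernel f) η =
    ∫ t in Set.Ioi (0 : ℝ), (f t : ℂ) * (t : ℂ) ^ (Complex.I * ((2 * Real.pi * η : ℝ) : ℂ)) := by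
  have h_mellin := mellin_eq_fourier (fun t => (f t : ℂ))
    (s := 1 + Complex.I * (2 * Real.pi * η : ℝ))
  have h_re : (1 + Complex.I * (2 * Real.pi * η : ℝ) : ℂ).re = 1 := by simp
  have h_im : (1 + Complex.I * (2 * Real.pi * η : ℝ) : ℂ).im = 2 * Real.pi * η := by simp
  rw [h_re, h_im, mul_div_cancel_left₀ _ (by positivity)] at h_mellin
  simp only [neg_one_mul] at h_mellin
  rw [show logKernel f = fun u => Real.exp (-u) • (f (Real.exp (-u)) : ℂ) from rfl, ← h_mellin,
    mellin]
  simp only [add_sub_cancel_left, smul_eq_mul, mul_comm]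

variable {E : Type*} [NormedAddCommGroup E] {φ : ℝ → E}

/-- The symmetrization of `φ` about `x`, as a function of the logarithm of the distance to `x`. -/
noncomputable def logSymmetrization (φ : ℝ → E) (x v : ℝ) : E :=
  φ (x - Real.exp v) + φ (x + Real.exp v)

theorem memLp_top_logSymmetrization (hφ : MemLp φ ∞) (x : ℝ) :
    MemLp (logSymmetrization φ x) ∞ :=
  (memLp_top_comp_of_quasiMeasurePreserving hφ
    ((Measure.measurePreserving_sub_left volume x).quasiMeasurePreserving.comp
      quasiMeasurePreserving_exp)).add
  (memLp_top_comp_of_quasiMeasurePreserving hφ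
    ((measurePreserving_add_left volume x).quasiMeasurePreserving.comp
      quasiMeasurePreserving_exp))

variable [NormedSpace ℂ E] {f g : ℝ → ℝ} {r : ℝ} {γ : Filter ℝ}

theorem convolution_dilate_eq_logKernel_convolution (hf : Integrable f) (hf_even : IsEvenAE f)
    (hφ : MemLp φ ∞) (hr : 0 < r) (x : ℝ) :
    (dilate f r ⋆ φ) x = (logKernel f ⋆[lsmul ℂ ℂ] logSymmetrization φ x) (Real.log r) := by
  have h_int : Integrable fun t => dilate f r t • φ (x - t) :=
    (integrable_dilate hf hr.ne').smul_of_top_left (memLp_top_comp_sub_left hφ x)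
  rw [convolution_lsmul, convolution_lsmul_swap, integral_eq_integral_Ioi_neg_add h_int]
  calc ∫ t in Set.Ioi 0, (dilate f r (-t) • φ (x - -t) + dilate f r t • φ (x - t))
      = ∫ t in Set.Ioi 0, dilate f r t • (φ (x - t) + φ (x + t)) := by
        refine integral_congr_ae (ae_restrict_of_ae ?_)
        filter_upwards [isEvenAE_dilate hf_even hr.ne'] with t ht
        simp only [ht, sub_neg_eq_add, smul_add, add_comm]
    _ = ∫ v, Real.exp v • dilate f r (Real.exp v) • logSymmetrization φ x v :=
        integral_Ioi_eq_integral_exp _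
    _ = ∫ v, logKernel f (Real.log r - v) • logSymmetrization φ x v := by
        refine integral_congr_ae (.of_forall fun v => ?_)
        beta_reduce
        have h_exp : Real.exp (-(Real.log r - v)) = Real.exp v / r := by
          rw [neg_sub, Real.exp_sub, Real.exp_log hr]
        rw [logKernel, h_exp, dilate, Complex.real_smul, ← Complex.ofReal_mul, Complex.coe_smul,
          smul_smul]
        congr 1
        ring

variable [CompleteSpace E]

theorem convolution_dilate_const (f : ℝ → ℝ) (hr : 0 < r) (a : E) (x : ℝ) :
    (dilate f r ⋆ fun _ => a) x = (∫ t, f t) • a := by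
  rw [convolution_lsmul, integral_smul_const, integral_dilate f hr]

theorem tendsto_convolution_dilate_zero [γ.IsCountablyGenerated] (hγ_pos : ∀ᶠ r in γ, 0 < r)
    (hγ_mul : ∀ c > 0, Tendsto (c * ·) γ γ) (hφ : MemLp φ ∞)
    (hf : Integrable f) (hf_even : IsEvenAE f)
    (hf_mellin : ∀ ξ : ℝ, ∫ t in Set.Ioi (0 : ℝ), (f t : ℂ) * (t : ℂ) ^ (Complex.I * (ξ : ℂ)) ≠ 0)
    (x : ℝ) (h : Tendsto (fun r => (dilate f r ⋆ φ) x) γ (𝓝 0))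
    (hg : Integrable g) (hg_even : IsEvenAE g) :
    Tendsto (fun r => (dilate g r ⋆ φ) x) γ (𝓝 0) := by
  let l := comap Real.exp γ
  have hl (y : ℝ) : Tendsto (· - y) l l := by
    refine tendsto_comap_iff.2
      (((hγ_mul _ (Real.exp_pos (-y))).comp tendsto_comap).congr fun u => ?_)
    simp only [Function.comp_apply, ← Real.exp_add, neg_add_eq_sub]
  have h_log : Tendsto Real.log γ l :=
    tendsto_comap_iff.2 (tendsto_id.congr' (hγ_pos.mono fun r hr => (Real.exp_log hr).symm))
  have hf_log : Tendsto (logKernel f ⋆[lsmul ℂ ℂ] logSymmetrization φ x) l (𝓝 0) := by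
    refine (h.comp tendsto_comap).congr fun u => ?_
    rw [Function.comp_apply, convolution_dilate_eq_logKernel_convolution hf hf_even hφ
      (Real.exp_pos u), Real.log_exp]
  have hg_log : Tendsto (logKernel g ⋆[lsmul ℂ ℂ] logSymmetrization φ x) l (𝓝 0) :=
    wiener_tauberian hl (integrable_logKernel hf)
      (fun η => (fourier_logKernel f η).trans_ne (hf_mellin _)) (memLp_top_logSymmetrization hφ x)
      hf_log (integrable_logKernel hg)
  exact (hg_log.comp h_log).congr' (hγ_pos.mono fun r hr =>
    (convolution_dilate_eq_logKernel_convolution hg hg_even hφ hr x).symm)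

theorem theorem4p5_general [γ.IsCountablyGenerated] (hγ_pos : ∀ᶠ r in γ, 0 < r)
    (hγ_mul : ∀ c > 0, Tendsto (c * ·) γ γ) (hφ : MemLp φ ∞)
    (hf : Integrable f) (hf_even : IsEvenAE f)
    (hf_mellin : ∀ ξ : ℝ, ∫ t in Set.Ioi (0 : ℝ), (f t : ℂ) * (t : ℂ) ^ (Complex.I * (ξ : ℂ)) ≠ 0)
    (x : ℝ) (a : E) (h : Tendsto (fun r => (dilate f r ⋆ φ) x) γ (𝓝 ((∫ t, f t) • a)))
    (hg : Integrable g) (hg_even : IsEvenAE g) :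
    Tendsto (fun r => (dilate g r ⋆ φ) x) γ (𝓝 ((∫ t, g t) • a)) := by
  have h_sub {k : ℝ → ℝ} (hk : Integrable k) : ∀ᶠ r in γ,
      (dilate k r ⋆ φ) x - (∫ t, k t) • a = (dilate k r ⋆ (φ - fun _ => a)) x := by
    filter_upwards [hγ_pos] with r hr
    have hk_dilate := integrable_dilate hk hr.ne'
    rw [← convolution_dilate_const k hr a x]
    simp only [convolution_lsmul, Pi.sub_apply, smul_sub]
    exact (integral_sub (hk_dilate.smul_of_top_left (memLp_top_comp_sub_left hφ x))
      (hk_dilate.smul_const a)).symm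
  rw [← tendsto_sub_nhds_zero_iff] at h ⊢
  rw [tendsto_congr' (h_sub hf)] at h
  rw [tendsto_congr' (h_sub hg)]
  exact tendsto_convolution_dilate_zero hγ_pos hγ_mul (hφ.sub (memLp_top_const a)) hf hf_even
    hf_mellin x h hg hg_even

end LogarithmicCoordinates

theorem theorem4p5
    (φ : ℝ → ℂ) (hφ : MemLp φ ∞ volume)
    (f : ℝ → ℝ) (hf : MemP f) (hf_even : IsEvenAE f)
    (hf_mellin : ∀ ξ : ℝ, ∫ t in Set.Ioi (0 : ℝ), (f t : ℂ) * (t : ℂ) ^ (Complex.I * (ξ : ℂ)) ≠ 0)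
    (γ : Filter ℝ) (hγ : γ = 𝓝[>] (0 : ℝ) ∨ γ = atTop)
    (x : ℝ) (α : ℂ)
    (h : Tendsto (fun r : ℝ => (dilate f r ⋆ φ) x) γ (𝓝 α))
    (g : ℝ → ℝ) (hg : MemP g) (hg_even : IsEvenAE g) :
    Tendsto (fun r : ℝ => (dilate g r ⋆ φ) x) γ (𝓝 α) := by
  rw [← one_smul ℝ α, ← hf.integral_eq_one] at h
  rw [← one_smul ℝ α, ← hg.integral_eq_one]
  rcases hγ with rfl | rfl
  · exact theorem4p5_general self_mem_nhdsWithin (fun c hc _ => eventually_nhdsGT_zero_mul_left hc)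
      hφ hf.integrable hf_even hf_mellin x α h hg.integrable hg_even
  · exact theorem4p5_general (eventually_gt_atTop 0) (fun c hc => tendsto_id.const_mul_atTop hc)
      hφ hf.integrable hf_even hf_mellin x α h hg.integrable hg_even
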